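/- Let $p$ be a prime number and let $G$ be an infinite group such that: - $G$ is characteristically simple, i.e. $G$ is non-trivial and its only characteristic subgroups (subgroups invariant under all automorphisms of the group $G$) are $\{e\}$ and $G$; - $G$ is a $p$-group, i.e. the order of every element of $G$ is a power of $p$; - $G$ is $\omega$-categorical, i.e. the complete first-order theory $\mathrm{Th}(G)$ of $G$ in the language of groups has, up to isomorphism, at most one model of cardinality $\aleph_0$; - $G$ has NIP, i.e. there are no formula $\varphi(x,y)$ of the language of groups ($x$, $y$ finite tuples of variables), model $M$ of $\mathrm{Th}(G)$, and tuples $(a_i)_{i<\omega}$ and $(b_w)_{w\subseteq\omega}$ in $M$ such that for all $i<\omega$ and $w\subseteq\omega$ one has $M\models\varphi(a_i,b_w)$ if and only if $i\in w$. Then $G$ has an infinite abelian subgroup $A$ which is definable in $G$ (with parameters) in the language of groups. Moreover, $A$ can be taken to be the center $A=Z\big(C_G(x_0)\cap\dots\cap C_G(x_n)\big)$ of the intersection of the centralizers of finitely many elements $x_0,\dots,x_n\in G$. -/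

import Mathlib

universe u v

namespace FirstOrder

/-- The function symbols of the language of groups: multiplication, inversion, neutral element. -/
inductive groupFunc : ℕ → Type
  | mul : groupFunc 2
  | inv : groupFunc 1
  | one : groupFunc 0

/-- The first-order language of groups `(·, ⁻¹, 1)`. -/
def Language.group : Language.{0, 0} where
  Functions := groupFunc
  Relations := fun _ => Empty

/-- Every group is a structure for the language of groups, with the obvious interpretation. -/
instance groupStructure (G : Type u) [Group G] : Language.group.Structure G where
  funMap := fun {_} f =>
    match f with
    | .mul => fun x => x 0 * x 1
    | .inv => fun x => (x 0)⁻¹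
    | .one => fun _ => 1
  RelMap := fun {_} r => Empty.elim r

/-- `T` has NIP: there are no formula `φ(x, y)` (in finite tuples of variables `x`, `y`), model `M`
of `T`, tuples `a i` (`i : ℕ`) and tuples `b w` (`w ⊆ ℕ`) in `M` such that `φ(a i, b w)` holds in
`M` if and only if `i ∈ w`. (Models of `T` in the universe of the language, hence of every
cardinality needed for such a configuration, play the role of the monster model.) -/
def Language.Theory.HasNIP {L : Language.{u, v}} (T : L.Theory) : Prop :=
  ¬ ∃ (m n : ℕ) (φ : L.Formula (Fin m ⊕ Fin n)) (M : Language.Theory.ModelType.{u, v, max u v} T)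
      (a : ℕ → Fin m → M) (b : Set ℕ → Fin n → M),
    ∀ (w : Set ℕ) (i : ℕ), φ.Realize (Sum.elim (a i) (b w)) ↔ i ∈ w

end FirstOrder

/-- A group is `ω`-categorical if its complete theory, in the language of groups, has up to
isomorphism at most one model of cardinality `ℵ₀`. -/
def Group.IsOmegaCategorical (G : Type u) [Group G] : Prop :=
  Cardinal.Categorical (Cardinal.aleph0.{0}) (FirstOrder.Language.group.completeTheory G)

/-- A group has NIP if its complete theory, in the language of groups, has NIP. -/
def Group.HasNIP (G : Type u) [Group G] : Prop :=
  (FirstOrder.Language.group.completeTheory G).HasNIP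

/-- A group is characteristically simple if it is nontrivial and its only characteristic subgroups
are the trivial subgroup and the whole group. -/
def Group.IsCharacteristicallySimple (G : Type u) [Group G] : Prop :=
  Nontrivial G ∧ ∀ H : Subgroup G, H.Characteristic → H = ⊥ ∨ H = ⊤

-- By ω-categoricity, finite tuples of fixed length realize only finitely many types:
-- `exists_ne_forall_realize_iff_of_categorical_aleph0`, proved by omitting types. Hence G is
-- locally finite, and the finite members of a uniformly definable family have bounded size. A large
-- finite p-group has a large abelian subgroup, so G contains arbitrarily large finite commuting
-- sets s. NIP provides N, independent of s, such that C(s) = C(t) for some t ⊆ s with at most N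
-- elements (`Subgroup.exists_subset_card_le_centralizer_eq`). As s is commuting, s ⊆ Z(C(s)) =
-- Z(C(t)). The groups Z(C(t)) are uniformly definable and arbitrarily large, so one of them is
-- infinite.

universe w

/-! ### Omitting types -/

namespace FirstOrder.Language

open Filter

variable {L : Language.{u, v}} {M : Type w} [L.Structure M]

theorem Formula.realize_congr_of_eqOn {α : Type*} [DecidableEq α] (φ : L.Formula α)
    {v w : α → M} (h : Set.EqOn v w φ.freeVarFinset) : φ.Realize v ↔ φ.Realize w := by
  have hv := BoundedFormula.realize_restrictFreeVar' (φ := φ) (M := M) Set.Subset.rfl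
    (v := v) (xs := default)
  have hw := BoundedFormula.realize_restrictFreeVar' (φ := φ) (M := M) Set.Subset.rfl
    (v := w) (xs := default)
  rw [Formula.Realize, Formula.Realize, ← hv, ← hw]
  have : v ∘ (Subtype.val : ↥(φ.freeVarFinset : Set α) → α) = w ∘ Subtype.val := funext fun a => h a.2
  rw [this]

/-- The image of a `∅`-definable set of assignments of countably many variables under restriction
to finitely many of them is `∅`-definable. -/
theorem Formula.exists_realize_iff_exists_comp {α : Type*} [Finite α] [Nonempty M]
    (φ : L.Formula ℕ) (j : α → ℕ) :
    ∃ θ : L.Formula α, ∀ x : α → M, θ.Realize x ↔ ∃ v : ℕ → M, φ.Realize v ∧ v ∘ j = x := by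
  classical
  let s : Set ℕ := (φ.freeVarFinset : Set ℕ) ∪ Set.range j
  have : Finite s := ((Finset.finite_toSet _).union (Set.finite_range j)).to_subtype
  have hs : (φ.freeVarFinset : Set ℕ) ⊆ s := Set.subset_union_left
  let φ' : L.Formula s := φ.restrictFreeVar (Set.inclusion hs)
  have hφ' (v : ℕ → M) : φ'.Realize (v ∘ (↑)) ↔ φ.Realize v :=
    BoundedFormula.realize_restrictFreeVar' hs
  let j' : α → s := fun a => ⟨j a, Or.inr ⟨a, rfl⟩⟩
  have hd : (∅ : Set M).Definable L (Set.ofPred φ'.Realize) :=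
    Set.empty_definable_iff.2 ⟨φ', rfl⟩
  obtain ⟨θ, hθ⟩ := Set.empty_definable_iff.1 (hd.image_comp j')
  refine ⟨θ, fun x => ?_⟩
  have hx : θ.Realize x ↔ x ∈ (fun g : s → M => g ∘ j') '' Set.ofPred φ'.Realize := by
    rw [hθ]; rfl
  rw [hx]
  constructor
  · rintro ⟨g, hg, rfl⟩
    let v : ℕ → M := fun n => if h : n ∈ s then g ⟨n, h⟩ else Classical.arbitrary M
    have hv : v ∘ ((↑) : s → ℕ) = g := funext fun a => by simp [v]
    refine ⟨v, (hφ' v).1 (by rw [hv]; exact hg), funext fun a => ?_⟩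
    change (v ∘ ((↑) : s → ℕ)) (j' a) = g (j' a)
    rw [hv]
  · rintro ⟨v, hv, rfl⟩
    exact ⟨v ∘ (↑), (hφ' v).2 hv, rfl⟩

variable (L M) in
/-- Nonempty sets of assignments of countably many variables cut out by a formula; smaller sets are
larger in the order. -/
structure Condition where
  formula : L.Formula ℕ
  satisfiable : ∃ v : ℕ → M, formula.Realize v

instance : Preorder (Condition L M) where
  le c d := ∀ v : ℕ → M, d.formula.Realize v → c.formula.Realize v
  le_refl _ _ h := h
  le_trans _ _ _ h₁ h₂ v h := h₁ v (h₂ v h)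

namespace Condition

/-- Henkin step: a condition mentions finitely many variables, so a fresh variable m can be made to
name a witness. -/
theorem isCofinal_witness [Nonempty M] (ψ : L.Formula ℕ) (i : ℕ) :
    IsCofinal {c : Condition L M |
      (∀ v : ℕ → M, c.formula.Realize v → ∀ a, ¬ ψ.Realize (Function.update v i a)) ∨
      ∃ m, ∀ v : ℕ → M, c.formula.Realize v → ψ.Realize (Function.update v i (v m))} := by
  intro c
  by_cases h : ∀ v : ℕ → M, c.formula.Realize v → ∀ a, ¬ ψ.Realize (Function.update v i a)
  · exact ⟨c, Or.inl h, le_rfl⟩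
  push Not at h
  obtain ⟨v, hv, a, ha⟩ := h
  obtain ⟨m, hm⟩ := Infinite.exists_notMem_finset
    (insert i (c.formula.freeVarFinset ∪ ψ.freeVarFinset))
  simp only [Finset.mem_insert, Finset.mem_union, not_or] at hm
  let g : ℕ → ℕ := Function.update id i m
  have hg (v : ℕ → M) : v ∘ g = Function.update v i (v m) := by
    funext k
    by_cases hk : k = i <;> simp [g, hk]
  refine ⟨⟨c.formula ⊓ ψ.relabel g, Function.update v m a, ?_⟩, Or.inr ⟨m, ?_⟩, ?_⟩
  · rw [Formula.realize_inf]
    refine ⟨(c.formula.realize_congr_of_eqOn fun k hk => ?_).1 hv, ?_⟩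
    · rw [Function.update_of_ne]
      rintro rfl
      exact hm.2.1 hk
    · rw [Formula.realize_relabel, hg]
      refine (ψ.realize_congr_of_eqOn fun k hk => ?_).1 ha
      by_cases hki : k = i
      · simp [hki]
      · have : k ≠ m := by
          rintro rfl
          exact hm.2.2 hk
        simp [hki, this]
  · intro v hv
    rw [Formula.realize_inf, Formula.realize_relabel, hg] at hv
    exact hv.2
  · intro v hv
    exact (Formula.realize_inf.1 hv).1

/-- The projection of a condition to the coordinates `j` is definable; since it does not isolate
`Q`, the condition can be strengthened by the negation of a member of `Q`. -/
theorem isCofinal_omit [Nonempty M] {α : Type*} [Finite α] {Q : Set (L.Formula α)}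
    (hQ : ∀ θ : L.Formula α, (∃ x : α → M, θ.Realize x) →
      ∃ χ ∈ Q, ∃ x : α → M, θ.Realize x ∧ ¬ χ.Realize x) (j : α → ℕ) :
    IsCofinal {c : Condition L M | ∃ χ ∈ Q, ∀ v : ℕ → M, c.formula.Realize v → ¬ χ.Realize (v ∘ j)} := by
  intro c
  obtain ⟨θ, hθ⟩ := c.formula.exists_realize_iff_exists_comp (M := M) j
  obtain ⟨v, hv⟩ := c.satisfiable
  obtain ⟨χ, hχ, x, hx, hxχ⟩ := hQ θ ⟨v ∘ j, (hθ _).2 ⟨v, hv, rfl⟩⟩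
  obtain ⟨w, hw, rfl⟩ := (hθ x).1 hx
  refine ⟨⟨c.formula ⊓ (χ.relabel j).not, w, ?_⟩, ⟨χ, hχ, fun v hv => ?_⟩, fun v hv => ?_⟩
  · rw [Formula.realize_inf, Formula.realize_not, Formula.realize_relabel]
    exact ⟨hw, hxχ⟩
  · rw [Formula.realize_inf, Formula.realize_not, Formula.realize_relabel] at hv
    exact hv.2
  · exact (Formula.realize_inf.1 hv).1

end Condition

/-- Tarski–Vaught test for the range of a sequence. -/
theorem exists_elementarySubstructure_coe_eq_range (v : ℕ → M)
    (h : ∀ (ψ : L.Formula ℕ) (i : ℕ) (a : M), ψ.Realize (Function.update v i a) →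
      ∃ m, ψ.Realize (Function.update v i (v m))) :
    ∃ S : L.ElementarySubstructure M, (S : Set M) = Set.range v := by
  have key (n : ℕ) (φ : L.Formula (Fin (n + 1))) (j : Fin n → ℕ) (a : M)
      (ha : φ.Realize (Fin.snoc (v ∘ j) a : Fin (n + 1) → M)) :
      ∃ m, φ.Realize (Fin.snoc (v ∘ j) (v m) : Fin (n + 1) → M) := by
    obtain ⟨i, hi⟩ := Infinite.exists_notMem_finset (Finset.univ.image j)
    have hi' : ∀ k, j k ≠ i := fun k hk => hi (by simp [← hk])
    let g : Fin (n + 1) → ℕ := Fin.snoc j i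
    have hg (b : M) : Function.update v i b ∘ g = Fin.snoc (v ∘ j) b := by
      funext k
      refine Fin.lastCases ?_ (fun k => ?_) k
      · simp [g]
      · simp [g, Function.update_of_ne (hi' k)]
    obtain ⟨m, hm⟩ := h (φ.relabel g) i a (by rwa [Formula.realize_relabel, hg])
    exact ⟨m, by rwa [Formula.realize_relabel, hg] at hm⟩
  -- Closure under f follows from `key` applied to the graph of f.
  let S : L.Substructure M :=
    { carrier := Set.range v
      fun_mem := by
        intro n f x hx
        choose j hj using hx
        have hj' : v ∘ j = x := funext hj
        have hr (b : M) : ((Term.func f fun k : Fin n => (Term.var k.castSucc : L.Term _)).equal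
            (Term.var (Fin.last n))).Realize (Fin.snoc (v ∘ j) b : Fin (n + 1) → M) ↔
              Structure.funMap f x = b := by
          rw [Formula.realize_equal, ← hj']
          simp [Term.realize_func, Function.comp_def]
        obtain ⟨m, hm⟩ := key n _ j (Structure.funMap f x) ((hr _).2 rfl)
        exact ⟨m, ((hr _).1 hm).symm⟩ }
  refine ⟨S.toElementarySubstructure fun n φ x a ha => ?_, rfl⟩
  have hx (k) : ∃ m, v m = x k := (x k).2
  choose j hj using hx
  have hj' : v ∘ j = (↑) ∘ x := funext hj
  let φ' : L.Formula (Fin (n + 1)) := φ.toFormula.relabel (Sum.elim Empty.elim id)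
  have hφ' (y : Fin (n + 1) → M) : φ'.Realize y ↔ φ.Realize default y := by
    rw [Formula.realize_relabel, BoundedFormula.realize_toFormula]
    have : (y ∘ Sum.elim Empty.elim id) ∘ Sum.inl = default := Subsingleton.elim _ _
    rw [this]
    rfl
  obtain ⟨m, hm⟩ := key n φ' j a (by rw [hφ', hj']; exact ha)
  refine ⟨⟨v m, m, rfl⟩, ?_⟩
  rw [hφ', hj'] at hm
  exact hm

/-- The omitting types theorem, inside a countable ultrapower. -/
theorem exists_elementarySubstructure_omitting [Countable L.Symbols] [Nonempty M]
    {α : Type*} [Finite α] {Q : Set (L.Formula α)}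
    (hQ : ∀ θ : L.Formula α, (∃ x : α → M, θ.Realize x) →
      ∃ χ ∈ Q, ∃ x : α → M, θ.Realize x ∧ ¬ χ.Realize x) :
    ∃ S : L.ElementarySubstructure ((hyperfilter ℕ : Filter ℕ).Product fun _ => M),
      Countable S ∧ ∀ x : α → S, ∃ χ ∈ Q, ¬ χ.Realize x := by
  let ι := (L.Formula ℕ × ℕ) ⊕ (α → ℕ)
  let _ : Encodable ι := Encodable.ofCountable ι
  let 𝒟 : ι → Order.Cofinal (Condition L M) := Sum.elim
    (fun x => ⟨_, Condition.isCofinal_witness x.1 x.2⟩)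
    (fun j => ⟨_, Condition.isCofinal_omit hQ j⟩)
  let c : ℕ → Condition L M := Order.sequenceOfCofinals ⟨⊤, Classical.arbitrary _, by simp⟩ 𝒟
  have hc : Monotone c := Order.sequenceOfCofinals.monotone _ _
  have hmem (i : ι) : ∃ n, c n ∈ 𝒟 i := ⟨_, Order.sequenceOfCofinals.encode_mem _ 𝒟 i⟩
  choose u hu using fun n => (c n).satisfiable
  have hev (n : ℕ) : ∀ᶠ k in (hyperfilter ℕ : Filter ℕ), (c n).formula.Realize (u k) := by
    have : ∀ᶠ k in (atTop : Filter ℕ), (c n).formula.Realize (u k) :=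
      (eventually_ge_atTop n).mono fun k hk => hc hk _ (hu k)
    exact Nat.hyperfilter_le_atTop this
  let N := (hyperfilter ℕ : Filter ℕ).Product fun _ => M
  -- `u k` satisfies every `c n` with n ≤ k, so by Łoś's theorem `v` satisfies all the conditions at
  -- once.
  let v : ℕ → N := fun i => ((fun k => u k i : ℕ → M) : N)
  obtain ⟨S, hS⟩ := exists_elementarySubstructure_coe_eq_range (L := L) v (by
    intro ψ i a ha
    obtain ⟨a, rfl⟩ := Quotient.exists_rep a
    have hupd (b : ℕ → M) : Function.update v i ((b : ℕ → M) : N) =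
        fun m => ((fun k => Function.update (u k) i (b k) m : ℕ → M) : N) := by
      funext m
      by_cases hm : m = i
      · subst hm
        simp only [Function.update_self]
        exact Function.update_self ..
      · simp only [Function.update_of_ne hm]
        exact Function.update_of_ne hm ..
    have ha' := (Ultraproduct.realize_formula_cast (u := hyperfilter ℕ) (M := fun _ => M) ψ
      fun m k => Function.update (u k) i (a k) m).1 (by rw [← hupd]; exact ha)
    obtain ⟨n, hn⟩ := hmem (Sum.inl (ψ, i))
    rcases hn with hn | ⟨m, hn⟩
    · obtain ⟨k, hk₁, hk₂⟩ := (ha'.and (hev n)).exists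
      exact absurd hk₁ (hn _ hk₂ _)
    · refine ⟨m, ?_⟩
      change ψ.Realize (Function.update v i (((fun k => u k m : ℕ → M)) : N))
      rw [hupd]
      exact (Ultraproduct.realize_formula_cast (u := hyperfilter ℕ) (M := fun _ => M) ψ _).2
        ((hev n).mono fun k hk => hn _ hk))
  refine ⟨S, ?_, fun x => ?_⟩
  · have : (S : Set N).Countable := hS ▸ Set.countable_range v
    exact this.to_subtype
  · have hx (a) : ∃ m, v m = x a := by
      have : (x a : N) ∈ (S : Set N) := (x a).2
      rwa [hS] at this
    choose j hj using hx
    obtain ⟨n, χ, hχ, hn⟩ := hmem (Sum.inr j)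
    refine ⟨χ, hχ, fun hr => ?_⟩
    have hr' : χ.Realize (((↑) : S → N) ∘ x) := (S.subtype.map_formula χ x).2 hr
    have hj' : ((↑) : S → N) ∘ x = fun a => ((fun k => u k (j a) : ℕ → M) : N) :=
      funext fun a => (hj a).symm
    rw [hj'] at hr'
    have := (Ultraproduct.realize_formula_cast (u := hyperfilter ℕ) (M := fun _ => M) χ _).1 hr'
    obtain ⟨k, hk₁, hk₂⟩ := (this.and (hev n)).exists
    exact hn _ hk₂ hk₁

end FirstOrder.Language

/-! ### Finiteness of types from ω-categoricity -/

namespace FirstOrder.Language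

open Filter Cardinal

variable {L : Language.{u, v}}

/-- Categoricity at `ℵ₀ : Cardinal.{0}` speaks of models in `Type`; models in other universes are
copied onto ℕ. -/
theorem nonempty_equiv_of_categorical_aleph0 {T : L.Theory}
    (h : Cardinal.Categorical (ℵ₀ : Cardinal.{0}) T) (M N : Type w) [L.Structure M] [L.Structure N]
    [M ⊨ T] [N ⊨ T] [Countable M] [Countable N] [Infinite M] [Infinite N] :
    Nonempty (M ≃[L] N) := by
  obtain ⟨e⟩ : Nonempty (M ≃ ℕ) := nonempty_equiv_of_countable
  obtain ⟨f⟩ : Nonempty (N ≃ ℕ) := nonempty_equiv_of_countable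
  let M₀ : T.ModelType := Theory.ModelType.equivInduced (M := Theory.ModelType.of T M) e
  let N₀ : T.ModelType := Theory.ModelType.equivInduced (M := Theory.ModelType.of T N) f
  obtain ⟨g⟩ := h M₀ N₀ Cardinal.mk_nat Cardinal.mk_nat
  let e' : M ≃[L] M₀ := e.inducedStructureEquiv
  let f' : N ≃[L] N₀ := f.inducedStructureEquiv
  exact ⟨f'.symm.comp (g.comp e')⟩

instance ultrapower_models_completeTheory {ι : Type*} (U : Ultrafilter ι) (M : Type w)
    [L.Structure M] [Nonempty M] :
    (U : Filter ι).Product (fun _ => M) ⊨ L.completeTheory M := by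
  refine ⟨fun φ hφ => ?_⟩
  rw [Ultraproduct.sentence_realize]
  exact Eventually.of_forall fun _ => hφ

theorem infinite_of_models_completeTheory {M : Type w} {N : Type*} [L.Structure M] [L.Structure N]
    [Infinite M] [N ⊨ L.completeTheory M] : Infinite N := by
  have h : L.ElementarilyEquivalent M N :=
    elementarilyEquivalent_iff.2 fun φ => (realize_iff_of_model_completeTheory M N φ).symm
  exact h.infinite

/-- The nontrivial half of the Ryll-Nardzewski theorem. -/
theorem exists_ne_forall_realize_iff_of_categorical_aleph0 [Countable L.Symbols] {M : Type w}
    [L.Structure M] [Infinite M]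
    (hcat : Cardinal.Categorical (ℵ₀ : Cardinal.{0}) (L.completeTheory M))
    {α : Type*} [Finite α] (a : ℕ → α → M) :
    ∃ i j, i ≠ j ∧ ∀ φ : L.Formula α, φ.Realize (a i) ↔ φ.Realize (a j) := by
  by_contra! hne
  -- The limit of the types of the `a i`. If the latter are distinct, `Q` is not isolated: an
  -- isolating formula would hold at infinitely many `a i`, all of type `Q`.
  let Q : Set (L.Formula α) := {χ | ∀ᶠ i in (hyperfilter ℕ : Filter ℕ), χ.Realize (a i)}
  have hnot (φ : L.Formula α) (hφ : φ ∉ Q) : φ.not ∈ Q := by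
    change ∀ᶠ i in (hyperfilter ℕ : Filter ℕ), φ.not.Realize (a i)
    simp only [Formula.realize_not]
    exact Ultrafilter.eventually_not.2 hφ
  obtain ⟨S₁, hS₁c, hS₁⟩ := exists_elementarySubstructure_omitting (M := M) (Q := Q) (by
    by_contra! hθ
    obtain ⟨θ, ⟨x, hx⟩, hθ⟩ := hθ
    have hθQ : θ ∈ Q := by
      by_contra h
      exact Formula.realize_not.1 (hθ _ (hnot θ h) x hx) hx
    have hinf : {i | θ.Realize (a i)}.Infinite := fun hf =>
      (hyperfilter ℕ).compl_notMem_iff.2 hθQ (compl_mem_hyperfilter_of_finite hf)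
    obtain ⟨i, hi, j, hj, hij⟩ := hinf.nontrivial
    have key (x : α → M) (hx : θ.Realize x) (φ : L.Formula α) : φ.Realize x ↔ φ ∈ Q := by
      refine ⟨fun h => ?_, fun h => hθ φ h x hx⟩
      by_contra hφ
      exact Formula.realize_not.1 (hθ _ (hnot φ hφ) x hx) h
    obtain ⟨φ, hφ⟩ := hne i j hij
    have h₁ := key _ hi φ
    have h₂ := key _ hj φ
    tauto)
  let N := (hyperfilter ℕ : Filter ℕ).Product fun _ => M
  have : Infinite N := infinite_of_models_completeTheory (L := L) (M := M)
  -- This tuple realizes `Q`, so a countable model containing it cannot be isomorphic to `S₁`, which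
  -- omits `Q`.
  let c : α → N := fun k => ((fun i => a i k : ℕ → M) : N)
  obtain ⟨S₂, hcS₂, hS₂⟩ := exists_elementarySubstructure_card_eq L (Set.range c) (ℵ₀ : Cardinal.{0})
    le_rfl
    (by simp)
    (by simp only [Cardinal.lift_le_aleph0, Cardinal.lift_aleph0]; exact Cardinal.mk_le_aleph0)
    (by simp)
  have hT (S : L.ElementarySubstructure N) : S ⊨ L.completeTheory M :=
    (S.theory_model_iff _).2 (ultrapower_models_completeTheory (hyperfilter ℕ) M)
  have := hT S₁
  have := hT S₂
  have : Infinite S₁ := infinite_of_models_completeTheory (L := L) (M := M)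
  have : Infinite S₂ := infinite_of_models_completeTheory (L := L) (M := M)
  have : Countable S₂ := by
    rw [← Cardinal.mk_le_aleph0_iff]
    simpa using hS₂.le
  obtain ⟨e⟩ := nonempty_equiv_of_categorical_aleph0 hcat S₂ S₁
  let d : α → S₂ := fun k => ⟨c k, hcS₂ ⟨k, rfl⟩⟩
  obtain ⟨χ, hχ, hχe⟩ := hS₁ (e ∘ d)
  rw [StrongHomClass.realize_formula] at hχe
  refine hχe ((S₂.subtype.map_formula χ d).1 ?_)
  exact (Ultraproduct.realize_formula_cast (u := hyperfilter ℕ) (M := fun _ => M) χ _).2 hχ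

end FirstOrder.Language

/-! ### NIP and bounded shattering -/

namespace FirstOrder.Language

open Filter Cardinal

variable {L : Language.{u, v}}

/-- In a structure whose theory has NIP, a formula does not shatter arbitrarily large finite
sets. -/
theorem Theory.HasNIP.exists_not_shatters [Countable L.Symbols] {G : Type w} [L.Structure G]
    [Infinite G] (h : (L.completeTheory G).HasNIP) {m n : ℕ} (φ : L.Formula (Fin m ⊕ Fin n)) :
    ∃ N : ℕ, ∀ (a : ℕ → Fin m → G) (b : Set ℕ → Fin n → G),
      ∃ w : Set ℕ, ∃ i < N, ¬ (φ.Realize (Sum.elim (a i) (b w)) ↔ i ∈ w) := by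
  by_contra! hG
  choose a b hab using hG
  -- In the ultrapower the finite shattered configurations assemble into an infinite one.
  let U := (hyperfilter ℕ : Filter ℕ).Product fun _ => G
  have : Infinite U := infinite_of_models_completeTheory (L := L) (M := G)
  let A : ℕ → Fin m → U := fun i k => ((fun N => a N i k : ℕ → G) : U)
  let B : Set ℕ → Fin n → U := fun w k => ((fun N => b N w k : ℕ → G) : U)
  have hAB (w : Set ℕ) (i : ℕ) : φ.Realize (Sum.elim (A i) (B w)) ↔ i ∈ w := by
    have hs : Sum.elim (A i) (B w) =
        fun k => ((fun N => Sum.elim (a N i) (b N w) k : ℕ → G) : U) := by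
      funext k
      cases k <;> rfl
    have hev : ∀ᶠ N in (hyperfilter ℕ : Filter ℕ),
        (φ.Realize (Sum.elim (a N i) (b N w)) ↔ i ∈ w) :=
      Nat.hyperfilter_le_atTop ((eventually_gt_atTop i).mono fun N hN => hab N w i hN)
    rw [hs]
    refine (Ultraproduct.realize_formula_cast (u := hyperfilter ℕ) (M := fun _ => G) φ
      fun k N => Sum.elim (a N i) (b N w) k).trans ?_
    exact (eventually_congr hev).trans eventually_const
  have hBinj : Function.Injective B := fun w w' hw => by
    ext i
    rw [← hAB w i, ← hAB w' i, hw]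
  -- `HasNIP` speaks of models in universe `max u v`; an elementary substructure of size continuum
  -- holds all the `B w` and can be copied there.
  let X := ULift.{max u v} (Set ℕ)
  have hX : #X = 𝔠 := by simp [X]
  let f : (ℕ × Fin m) ⊕ (Set ℕ × Fin n) → U := Sum.elim (fun p => A p.1 p.2) fun p => B p.1 p.2
  obtain ⟨S, hfS, hS⟩ := exists_elementarySubstructure_card_eq L (Set.range f) #X
    (by rw [hX]; exact aleph0_le_continuum)
    (by
      have h₁ : #((ℕ × Fin m) ⊕ (Set ℕ × Fin n)) ≤ 𝔠 := by
        simp only [mk_sum, mk_prod, lift_id, mk_set, mk_nat, mk_fin,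
          two_power_aleph0]
        refine add_le_of_le aleph0_le_continuum
          ((mul_le_max _ _).trans (max_le (max_le aleph0_le_continuum ?_) aleph0_le_continuum))
          ((mul_le_max _ _).trans (max_le (max_le le_rfl ?_) aleph0_le_continuum))
        · exact (nat_lt_continuum _).le
        · exact (nat_lt_continuum _).le
      rw [hX, lift_continuum, lift_le_continuum]
      exact lift_le_continuum.1 ((mk_range_le_lift (f := f)).trans (lift_le_continuum.2 h₁)))
    (by
      rw [hX, lift_continuum, lift_le_continuum]
      exact (Cardinal.mk_le_aleph0 (α := L.Symbols)).trans aleph0_le_continuum)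
    (by
      rw [hX, lift_continuum, continuum_le_lift]
      -- `B` embeds the continuum into Uⁿ, and |Uⁿ| ≤ |U| because U is infinite.
      have h₁ := mk_le_of_injective (f := B ∘ ULift.down.{w})
        (hBinj.comp ULift.down_injective)
      rw [mk_uLift, mk_set_nat, lift_continuum, mk_arrow, mk_fin, lift_uzero, lift_natCast] at h₁
      exact h₁.trans (power_nat_le (aleph0_le_mk U)))
  obtain ⟨e⟩ := lift_mk_eq'.1 hS
  have : S ⊨ L.completeTheory G :=
    (S.theory_model_iff _).2 (ultrapower_models_completeTheory (hyperfilter ℕ) G)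
  let M : (L.completeTheory G).ModelType :=
    Theory.ModelType.equivInduced (M := Theory.ModelType.of _ S) e
  let e' : S ≃[L] M := e.inducedStructureEquiv
  let A' : ℕ → Fin m → S := fun i k => ⟨A i k, hfS ⟨Sum.inl (i, k), rfl⟩⟩
  let B' : Set ℕ → Fin n → S := fun w k => ⟨B w k, hfS ⟨Sum.inr (w, k), rfl⟩⟩
  refine h ⟨m, n, φ, M, fun i => e' ∘ A' i, fun w => e' ∘ B' w, fun w i => ?_⟩
  rw [← Sum.comp_elim, StrongHomClass.realize_formula, ← S.subtype.map_formula, ← hAB w i,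
    Sum.comp_elim]
  rfl

end FirstOrder.Language

/-! ### Large abelian subgroups of finite p-groups -/

/-- Take A maximal among abelian normal subgroups. If C(A) were not inside A, nilpotency would give
x in C(A) \ A central modulo A, and ⟨A, x⟩ would contradict maximality. -/
theorem IsPGroup.exists_normal_centralizer_le {p : ℕ} [Fact p.Prime] {P : Type*} [Group P]
    [Finite P] (hP : IsPGroup p P) :
    ∃ A : Subgroup P, A.Normal ∧ A ≤ Subgroup.centralizer (A : Set P) ∧
      Subgroup.centralizer (A : Set P) ≤ A := by
  obtain ⟨A, ⟨hAn, hAc⟩, hmax⟩ := (Set.toFinite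
    {A : Subgroup P | A.Normal ∧ A ≤ Subgroup.centralizer (A : Set P)}).exists_maximal
    ⟨⊥, inferInstance, bot_le⟩
  refine ⟨A, hAn, hAc, ?_⟩
  by_contra hle
  have hnil : Group.IsNilpotent P := hP.isNilpotent
  obtain ⟨n, hn⟩ := Group.isNilpotent_iff P |>.1 hnil
  let C := Subgroup.centralizer (A : Set P)
  have hex : ∃ k, ¬ C ⊓ Subgroup.upperCentralSeries P k ≤ A :=
    ⟨n, by rwa [hn, inf_top_eq]⟩
  classical
  obtain ⟨k, hk⟩ : ∃ k, Nat.find hex = k + 1 := Nat.exists_eq_succ_of_ne_zero fun h0 => by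
    have := Nat.find_spec hex
    rw [h0, Subgroup.upperCentralSeries_zero, inf_bot_eq] at this
    exact this bot_le
  have hk₁ : ¬ C ⊓ Subgroup.upperCentralSeries P (k + 1) ≤ A := hk ▸ Nat.find_spec hex
  have hk₀ : C ⊓ Subgroup.upperCentralSeries P k ≤ A :=
    not_not.1 (Nat.find_min hex (by omega))
  obtain ⟨x, ⟨hxC, hxZ⟩, hxA⟩ := SetLike.not_le_iff_exists.1 hk₁
  have hC : C.Normal := inferInstance
  have hconj (g : P) : g * x * g⁻¹ * x⁻¹ ∈ A := by
    refine hk₀ ⟨C.mul_mem (hC.conj_mem x hxC g) (C.inv_mem hxC), ?_⟩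
    have := Subgroup.mem_upperCentralSeries_succ_iff.1 hxZ g
    have := Subgroup.inv_mem _ this
    convert! this using 1
    group
  let B := Subgroup.closure (insert x (A : Set P))
  have hAB : A ≤ B := fun a ha => Subgroup.subset_closure (Set.mem_insert_of_mem _ ha)
  have hxB : x ∈ B := Subgroup.subset_closure (Set.mem_insert _ _)
  have hBn : B.Normal := ⟨fun b hb g => by
    induction hb using Subgroup.closure_induction with
    | mem y hy =>
      rcases hy with rfl | hy
      · have := B.mul_mem (hAB (hconj g)) hxB
        rwa [inv_mul_cancel_right] at this
      · exact hAB (hAn.conj_mem y hy g)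
    | one => simp
    | mul y z _ _ hy hz =>
      have := B.mul_mem hy hz
      simpa [mul_assoc] using this
    | inv y _ hy =>
      have := B.inv_mem hy
      simpa [mul_assoc] using this⟩
  have hBc : B ≤ Subgroup.centralizer (B : Set P) := by
    rw [Subgroup.centralizer_closure, Subgroup.closure_le]
    rintro y (rfl | hy) <;> rw [SetLike.mem_coe, Subgroup.mem_centralizer_iff]
    · rintro z (rfl | hz)
      · rfl
      · exact Subgroup.mem_centralizer_iff.1 hxC z hz
    · rintro z (rfl | hz)
      · exact (Subgroup.mem_centralizer_iff.1 hxC y hy).symm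
      · exact Subgroup.mem_centralizer_iff.1 (hAc hy) z hz
  exact hxA (hmax ⟨hBn, hBc⟩ hAB hxB)

/-- P acts on a self-centralizing normal abelian A by conjugation: the kernel lies in A, and the
image embeds in the permutations of A. -/
theorem IsPGroup.card_le_of_forall_commutative_card_le {p : ℕ} [Fact p.Prime] {P : Type*} [Group P]
    [Finite P] (hP : IsPGroup p P) {K : ℕ}
    (hK : ∀ A : Subgroup P, A ≤ Subgroup.centralizer (A : Set P) → Nat.card A ≤ K) :
    Nat.card P ≤ K * K.factorial := by
  obtain ⟨A, hAn, hAc, hcA⟩ := hP.exists_normal_centralizer_le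
  let f : P →* MulAut A := MulAut.conjNormal
  have hker : f.ker ≤ A := fun g hg => hcA <| Subgroup.mem_centralizer_iff.2 fun a ha => by
    have h := congrArg (fun e : MulAut A => ((e ⟨a, ha⟩ : A) : P)) (MonoidHom.mem_ker.1 hg)
    have h' : g * a * g⁻¹ = a := by simpa [f] using h
    exact (mul_inv_eq_iff_eq_mul.1 h').symm
  have h₁ : Nat.card f.ker ≤ K := (Subgroup.card_le_of_le hker).trans (hK A hAc)
  have h₂ : f.ker.index ≤ K.factorial := by
    rw [Subgroup.index_ker]
    calc Nat.card f.range ≤ Nat.card (MulAut A) := Subgroup.card_le_card_group _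
      _ ≤ Nat.card (Equiv.Perm A) := Nat.card_le_card_of_injective _ MulEquiv.toEquiv_injective
      _ = (Nat.card A).factorial := Nat.card_perm
      _ ≤ K.factorial := Nat.factorial_le (hK A hAc)
  rw [← f.ker.card_mul_index]
  exact Nat.mul_le_mul h₁ h₂

theorem IsPGroup.exists_finset_commute_card_gt {p : ℕ} [Fact p.Prime] {G : Type*} [Group G]
    [Infinite G] (hG : IsPGroup p G)
    (hfin : ∀ s : Finset G, Finite (Subgroup.closure (s : Set G))) (K : ℕ) :
    ∃ s : Finset G, K < s.card ∧ ∀ x ∈ s, ∀ y ∈ s, Commute x y := by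
  by_contra! h
  obtain ⟨s, hs⟩ := Infinite.exists_subset_card_eq G (K * K.factorial + 1)
  have := hfin s
  let P := Subgroup.closure (s : Set G)
  have hcard : s.card ≤ Nat.card P := by
    have := Nat.card_mono (Set.toFinite (P : Set G)) (Subgroup.subset_closure (k := (s : Set G)))
    simpa using this
  have hle := (hG.to_subgroup P).card_le_of_forall_commutative_card_le (K := K) fun A hA => by
    classical
    have hfin : (P.subtype '' (A : Set P)).Finite := (Set.toFinite _).image _
    let t : Finset G := hfin.toFinset
    have ht : t.card = Nat.card A := by
      rw [← Set.ncard_eq_toFinset_card _ hfin, Set.ncard_image_of_injective _ P.subtype_injective,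
        ← Nat.card_coe_set_eq]
      rfl
    rw [← ht]
    by_contra! hlt
    obtain ⟨x, hx, y, hy, hxy⟩ := h t hlt
    simp only [t, Set.Finite.mem_toFinset, Set.mem_image, SetLike.mem_coe] at hx hy
    obtain ⟨x, hx, rfl⟩ := hx
    obtain ⟨y, hy, rfl⟩ := hy
    exact hxy (congrArg P.subtype (Subgroup.mem_centralizer_iff.1 (hA hy) x hx))
  omega

/-! ### Centralizers under NIP -/

/-- If no large finite set of elements is shattered by the commuting relation, then centralizers of
finite sets are centralizers of small subsets. -/
theorem Subgroup.exists_subset_card_le_centralizer_eq {G : Type*} [Group G] {N : ℕ}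
    (hN : ∀ (a : ℕ → G) (b : Set ℕ → G), ∃ w : Set ℕ, ∃ i < N, ¬ (Commute (a i) (b w) ↔ i ∈ w))
    (s : Finset G) :
    ∃ t ⊆ s, t.card ≤ N ∧
      Subgroup.centralizer (t : Set G) = Subgroup.centralizer (s : Set G) := by
  classical
  obtain ⟨t, ht, hmin⟩ := Finset.exists_min_image
    (s.powerset.filter fun t : Finset G => Subgroup.centralizer (t : Set G) = Subgroup.centralizer (s : Set G))
    Finset.card ⟨s, by simp⟩
  simp only [Finset.mem_filter, Finset.mem_powerset] at ht hmin
  refine ⟨t, ht.1, ?_, ht.2⟩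
  by_contra! hlt
  -- By minimality of `t`, dropping y enlarges the centralizer.
  have hdrop (y : t) : ∃ b : G, ¬ Commute y.1 b ∧ ∀ z ∈ t, z ≠ y → Commute z b := by
    by_contra! hy
    have := hmin (t.erase y) ⟨(Finset.erase_subset _ _).trans ht.1, ?_⟩
    · exact absurd (Finset.card_erase_lt_of_mem y.2) (by omega)
    · rw [← ht.2]
      refine le_antisymm (fun b hb => ?_) (Subgroup.centralizer_le (by simp))
      rw [Subgroup.mem_centralizer_iff] at hb ⊢
      have hb' : ∀ z ∈ t, z ≠ y → Commute z b := fun z hz hzy => hb z (by simp [hz, hzy])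
      intro z hz
      by_contra hzb
      by_cases hzy : z = y
      · obtain ⟨z', hz', hne, hc⟩ := hy b (hzy ▸ hzb)
        exact hc (hb' z' hz' hne)
      · exact hzb (hb' z hz hzy)
  choose b hb hb' using hdrop
  let e : Fin t.card ≃ t := t.equivFin.symm
  let x (i : ℕ) : G := if h : i < t.card then e ⟨i, h⟩ else 1
  let β (i : ℕ) : G := if h : i < t.card then b (e ⟨i, h⟩) else 1
  have hxβ {i j : ℕ} (hi : i < N) (hj : j < N) : Commute (x i) (β j) ↔ i ≠ j := by
    have hi' := hi.trans hlt
    have hj' := hj.trans hlt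
    simp only [x, β, hi', hj', dif_pos]
    refine ⟨fun h hij => ?_, fun hij => hb' _ _ (e ⟨i, hi'⟩).2 fun h => hij ?_⟩
    · subst hij
      exact hb _ h
    · simpa using e.injective (Subtype.ext h)
  -- The product of the `β l` over l < k outside w. Only the factor `β i` fails to commute with `x
  -- i`, so `c w N` commutes with `x i` exactly when i ∈ w.
  let c (w : Set ℕ) (k : ℕ) : G := Nat.rec 1 (fun k g => if k ∈ w then g else g * β k) k
  have hc (w : Set ℕ) (i : ℕ) (hi : i < N) (k : ℕ) (hk : k ≤ N) :
      Commute (x i) (c w k) ↔ i ∈ w ∨ k ≤ i := by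
    induction k with
    | zero => simp [c]
    | succ k ih =>
      have ih := ih (by omega)
      have hs : c w (k + 1) = if k ∈ w then c w k else c w k * β k := rfl
      by_cases hkw : k ∈ w
      · rw [hs, if_pos hkw, ih]
        constructor
        · rintro (h | h)
          · exact Or.inl h
          · rcases h.eq_or_lt with rfl | h
            · exact Or.inl hkw
            · exact Or.inr h
        · exact Or.imp_right fun h => by omega
      · rw [hs, if_neg hkw]
        by_cases hik : i = k
        · subst hik
          have h₁ : Commute (x i) (c w i) := ih.2 (Or.inr le_rfl)
          simp only [hkw, Nat.not_succ_le_self, or_self, iff_false]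
          intro h
          have h₂ : Commute (x i) (β i) := by
            have := h₁.inv_right.mul_right h
            rwa [inv_mul_cancel_left] at this
          exact (hxβ hi hi).1 h₂ rfl
        · have h₁ : Commute (x i) (β k) := (hxβ hi (by omega)).2 hik
          have h₂ : Commute (x i) (c w k * β k) ↔ Commute (x i) (c w k) :=
            ⟨fun h => by simpa using h.mul_right h₁.inv_right, fun h => h.mul_right h₁⟩
          rw [h₂, ih]
          have : k ≤ i ↔ k + 1 ≤ i := by omega
          rw [this]
  obtain ⟨w, i, hi, hiw⟩ := hN x fun w => c w N
  exact hiw ((hc w i hi N le_rfl).trans (by simp [hi]))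

/-! ### Uniform bounds and the language of groups -/

namespace FirstOrder.Language

theorem Formula.exists_realize_iff_exists_injective {L : Language.{u, v}} {α : Type*}
    (ψ : L.Formula (α ⊕ Unit)) (k : ℕ) (M : Type w) [L.Structure M] :
    ∃ θ : L.Formula α, ∀ x : α → M, θ.Realize x ↔ ∃ y : Fin k → M, Function.Injective y ∧
      ∀ i, ψ.Realize (Sum.elim x fun _ => y i) := by
  let δ : L.Formula (α ⊕ Fin k) := Formula.iInf fun q : {q : Fin k × Fin k // q.1 ≠ q.2} =>
    ((Term.var (Sum.inr q.1.1)).equal (Term.var (Sum.inr q.1.2))).not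
  let σ : L.Formula (α ⊕ Fin k) := Formula.iInf fun i : Fin k =>
    ψ.relabel (Sum.map id fun _ => i)
  refine ⟨(δ ⊓ σ).iExs (Fin k), fun x => ?_⟩
  rw [Formula.realize_iExs]
  refine exists_congr fun y => ?_
  rw [Formula.realize_inf]
  refine and_congr ?_ ?_
  · simp only [δ, Formula.realize_iInf, Formula.realize_not, Formula.realize_equal,
      Term.realize_var, Sum.elim_inr]
    exact ⟨fun h i j hij => by_contra fun hne => h ⟨(i, j), hne⟩ hij,
      fun h q hq => q.2 (h hq)⟩
  · simp only [σ, Formula.realize_iInf, Formula.realize_relabel]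
    refine forall_congr' fun i => ?_
    have : Sum.elim x y ∘ Sum.map id (fun _ : Unit => i) = Sum.elim x fun _ => y i := by
      funext k
      cases k <;> rfl
    rw [this]

/-- Having at least k solutions is first-order, so parameters of the same type give finite sets of
the same size; unboundedly many sizes would need infinitely many types. -/
theorem exists_ncard_le_of_categorical_aleph0 {L : Language.{u, v}} [Countable L.Symbols]
    {M : Type w} [L.Structure M] [Infinite M]
    (hcat : Cardinal.Categorical (Cardinal.aleph0.{0}) (L.completeTheory M))
    {α : Type*} [Finite α] (ψ : L.Formula (α ⊕ Unit)) :
    ∃ K : ℕ, ∀ x : α → M, {y : M | ψ.Realize (Sum.elim x fun _ => y)}.Finite →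
      {y : M | ψ.Realize (Sum.elim x fun _ => y)}.ncard ≤ K := by
  let S (x : α → M) : Set M := {y : M | ψ.Realize (Sum.elim x fun _ => y)}
  by_contra! h
  let T : Set ℕ := {k | ∃ x, (S x).Finite ∧ (S x).ncard = k}
  have hT : T.Infinite := Set.infinite_of_not_bddAbove fun ⟨K, hK⟩ => by
    obtain ⟨x, hx, hlt⟩ := h K
    exact absurd (hK ⟨x, hx, rfl⟩) (not_le.2 hlt)
  let f := hT.natEmbedding
  choose x hfin hcard using fun i => (f i).2
  obtain ⟨i, j, hij, htp⟩ := exists_ne_forall_realize_iff_of_categorical_aleph0 hcat x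
  have key (k i : ℕ) : k ≤ (S (x i)).ncard ↔ ∃ y : Fin k → M, Function.Injective y ∧
      ∀ l, ψ.Realize (Sum.elim (x i) fun _ => y l) := by
    constructor
    · intro hk
      have : Finite (S (x i)) := hfin i
      rw [← Nat.card_coe_set_eq] at hk
      let e := (Finite.equivFin (S (x i))).symm
      exact ⟨fun l => e (Fin.castLE hk l),
        Subtype.val_injective.comp (e.injective.comp (Fin.castLE_injective hk)),
        fun l => (e (Fin.castLE hk l)).2⟩
    · rintro ⟨y, hy, hyS⟩
      have := Set.ncard_le_ncard (s := Set.range y) (t := S (x i)) (by rintro _ ⟨l, rfl⟩; exact hyS l)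
        (hfin i)
      rwa [← Set.image_univ, Set.ncard_image_of_injective _ hy, Set.ncard_univ, Nat.card_fin] at this
  have hle (k : ℕ) : k ≤ (S (x i)).ncard ↔ k ≤ (S (x j)).ncard := by
    obtain ⟨θ, hθ⟩ := ψ.exists_realize_iff_exists_injective k M
    rw [key, key, ← hθ, ← hθ, htp]
  have heq : (S (x i)).ncard = (S (x j)).ncard :=
    le_antisymm ((hle _).1 le_rfl) ((hle _).2 le_rfl)
  rw [hcard, hcard] at heq
  exact hij (f.injective (Subtype.ext heq))

namespace group

instance : Countable Language.group.Symbols := by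
  have : ∀ n, Countable (Language.group.Functions n) := fun n => by
    have h : Function.Injective (fun f : groupFunc n => match n, f with
        | _, .mul => 0 | _, .inv => 1 | _, .one => (2 : ℕ)) := by
      intro f g hfg
      cases f <;> cases g <;> rfl
    exact h.countable
  have : ∀ n, Countable (Language.group.Relations n) := fun _ =>
    inferInstanceAs (Countable Empty)
  unfold Language.Symbols
  infer_instance

variable {α : Type*} {G : Type u} [Group G]

/-- The formula `t * s = s * t`. -/
def commute (t s : Language.group.Term α) : Language.group.Formula α :=
  (Term.func groupFunc.mul ![t, s]).equal (Term.func groupFunc.mul ![s, t])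

theorem realize_mul (t s : Language.group.Term α) (v : α → G) :
    (Term.func groupFunc.mul ![t, s] : Language.group.Term α).realize v =
      t.realize v * s.realize v := rfl

theorem realize_commute (t s : Language.group.Term α) (v : α → G) :
    (commute t s).Realize v ↔ Commute (t.realize v) (s.realize v) := by
  rw [commute, Formula.realize_equal, realize_mul, realize_mul]
  rfl

theorem exists_term_of_mem_closure (a : α → G) {g : G} (hg : g ∈ Subgroup.closure (Set.range a)) :
    ∃ t : Language.group.Term α, t.realize a = g := by
  induction hg using Subgroup.closure_induction with
  | mem x hx =>
    obtain ⟨i, rfl⟩ := hx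
    exact ⟨Term.var i, rfl⟩
  | one => exact ⟨Term.func groupFunc.one ![], rfl⟩
  | mul x y _ _ hx hy =>
    obtain ⟨t, rfl⟩ := hx
    obtain ⟨s, rfl⟩ := hy
    exact ⟨Term.func groupFunc.mul ![t, s], rfl⟩
  | inv x _ hx =>
    obtain ⟨t, rfl⟩ := hx
    exact ⟨Term.func groupFunc.inv ![t], rfl⟩

end group

end FirstOrder.Language

/-! ### Local finiteness and the infinite abelian subgroup -/

section

open FirstOrder FirstOrder.Language

/-- Each element of ⟨s⟩ is the value of a term in s, so distinct elements have distinct types over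
s. -/
theorem Group.IsOmegaCategorical.finite_closure {G : Type u} [Group G] [Infinite G]
    (hG : Group.IsOmegaCategorical G) (s : Finset G) : Finite (Subgroup.closure (s : Set G)) := by
  by_contra hinf
  rw [not_finite_iff_infinite] at hinf
  let g := Infinite.natEmbedding (Subgroup.closure (s : Set G))
  let a (i : ℕ) (k : Option s) : G := k.elim (g i) Subtype.val
  obtain ⟨i, j, hij, htp⟩ := exists_ne_forall_realize_iff_of_categorical_aleph0 hG a
  obtain ⟨t, ht⟩ := group.exists_term_of_mem_closure (Subtype.val : s → G) (g := g i)
    (by rw [Subtype.range_coe_subtype]; exact (g i).2)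
  have key (k : ℕ) : ((t.relabel some).equal (Term.var none)).Realize (a k) ↔
      (g i : G) = g k := by
    rw [Formula.realize_equal, Term.realize_relabel, ← ht]
    rfl
  exact hij (g.injective (Subtype.ext ((key j).1 ((htp _).1 ((key i).2 rfl)))))

/-- The elements of the center of the centralizer of a tuple. -/
def centerCentralizer {G : Type*} [Group G] {ι : Type*} (x : ι → G) : Set G :=
  {z | (∀ i, Commute z (x i)) ∧ ∀ c, (∀ i, Commute c (x i)) → Commute z c}

namespace FirstOrder.Language.group

/-- One formula serves all tuples `x`, which makes the bound on finite members uniform. -/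
theorem exists_formula_centerCentralizer (ι : Type*) [Finite ι] (G : Type u) [Group G] :
    ∃ ψ : Language.group.Formula (ι ⊕ Unit), ∀ (x : ι → G) (z : G),
      ψ.Realize (Sum.elim x fun _ => z) ↔ z ∈ centerCentralizer x := by
  let ψ₁ : Language.group.Formula (ι ⊕ Unit) := Formula.iInf fun i =>
    commute (Term.var (Sum.inr ())) (Term.var (Sum.inl i))
  let ψ₂ : Language.group.Formula ((ι ⊕ Unit) ⊕ Unit) := (Formula.iInf fun i : ι =>
    commute (Term.var (Sum.inr ())) (Term.var (Sum.inl (Sum.inl i)))).imp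
      (commute (Term.var (Sum.inl (Sum.inr ()))) (Term.var (Sum.inr ())))
  refine ⟨ψ₁ ⊓ ψ₂.iAlls Unit, fun x z => ?_⟩
  rw [Formula.realize_inf, Formula.realize_iAlls]
  refine and_congr ?_ ?_
  · simp [ψ₁, Formula.realize_iInf, realize_commute]
  · simp only [ψ₂, Formula.realize_imp, Formula.realize_iInf, realize_commute, Term.realize_var,
      Sum.elim_inl, Sum.elim_inr]
    exact ⟨fun h c hc => h (fun _ => c) hc, fun h c hc => h (c ()) hc⟩

end FirstOrder.Language.group

theorem definable_centerCentralizer {G : Type u} [Group G] {ι : Type*} [Finite ι] (x : ι → G) :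
    (Set.univ : Set G).Definable₁ Language.group (centerCentralizer x) := by
  obtain ⟨ψ, hψ⟩ := group.exists_formula_centerCentralizer ι G
  rw [Set.Definable₁, Set.definable_iff_exists_formula_sum]
  refine ⟨ψ.relabel (Sum.map (fun i => ⟨x i, trivial⟩) fun _ => 0), Set.ext fun v => ?_⟩
  have hv : Sum.elim (Subtype.val : ↥(Set.univ : Set G) → G) v ∘
      Sum.map (fun i => ⟨x i, trivial⟩) (fun _ : Unit => (0 : Fin 1)) =
        Sum.elim x fun _ => v 0 := by
    funext k
    cases k <;> rfl
  change v 0 ∈ centerCentralizer x ↔ Formula.Realize _ _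
  rw [Formula.realize_relabel, hv, hψ]

theorem Group.HasNIP.exists_not_shatters_commute {G : Type u} [Group G] [Infinite G]
    (hG : Group.HasNIP G) :
    ∃ N : ℕ, ∀ (a : ℕ → G) (b : Set ℕ → G),
      ∃ w : Set ℕ, ∃ i < N, ¬ (Commute (a i) (b w) ↔ i ∈ w) := by
  obtain ⟨N, hN⟩ := Theory.HasNIP.exists_not_shatters hG (m := 1) (n := 1)
    (group.commute (Term.var (Sum.inl 0)) (Term.var (Sum.inr 0)))
  refine ⟨N, fun a b => ?_⟩
  obtain ⟨w, i, hi, h⟩ := hN (fun i _ => a i) fun w _ => b w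
  rw [group.realize_commute] at h
  exact ⟨w, i, hi, h⟩

theorem exists_infinite_centerCentralizer {p : ℕ} [Fact p.Prime] {G : Type u} [Group G] [Infinite G]
    (hpgroup : IsPGroup p G) (hcat : Group.IsOmegaCategorical G) (hnip : Group.HasNIP G) :
    ∃ (N : ℕ) (x : Fin (N + 1) → G), (centerCentralizer x).Infinite := by
  classical
  obtain ⟨N, hN⟩ := hnip.exists_not_shatters_commute
  by_contra! hfin
  obtain ⟨ψ, hψ⟩ := group.exists_formula_centerCentralizer (Fin (N + 1)) G
  obtain ⟨K, hK⟩ := exists_ncard_le_of_categorical_aleph0 hcat ψ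
  obtain ⟨s, hs, hcomm⟩ := hpgroup.exists_finset_commute_card_gt hcat.finite_closure K
  obtain ⟨t, hts, htN, ht⟩ := Subgroup.exists_subset_card_le_centralizer_eq hN s
  -- Adding 1 leaves the centralizer unchanged and ensures that the set is nonempty, so it can be
  -- enumerated, with repetitions, by a tuple of fixed length N + 1.
  obtain ⟨x, hx⟩ : ∃ x : Fin (N + 1) → G, Set.range x = insert 1 (t : Set G) := by
    have hcard : (insert 1 t).card ≤ N + 1 := (Finset.card_insert_le _ _).trans (by omega)
    have : Nonempty (insert 1 t : Finset G) := ⟨⟨1, by simp⟩⟩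
    let e := (insert 1 t).equivFin
    obtain ⟨f, hf⟩ : ∃ f : Fin (N + 1) → (insert 1 t : Finset G), Function.Surjective f :=
      ⟨_, (Function.invFun_surjective ((Fin.castLE_injective hcard).comp e.injective))⟩
    refine ⟨Subtype.val ∘ f, ?_⟩
    rw [hf.range_comp, Subtype.range_coe_subtype]
    ext
    simp
  have hsub : (s : Set G) ⊆ centerCentralizer x := fun z hz => by
    refine ⟨fun i => ?_, fun c hc => ?_⟩
    · have hi : x i ∈ insert 1 (t : Set G) := hx ▸ Set.mem_range_self i
      rcases hi with hi | hi
      · rw [hi]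
        exact Commute.one_right z
      · exact hcomm z hz _ (hts hi)
    · have hct : c ∈ Subgroup.centralizer (t : Set G) := Subgroup.mem_centralizer_iff.2 fun y hy => by
        obtain ⟨i, rfl⟩ : y ∈ Set.range x := hx ▸ Set.mem_insert_of_mem _ hy
        exact (hc i).symm
      rw [ht] at hct
      exact Subgroup.mem_centralizer_iff.1 hct z hz
  have heq : {y : G | ψ.Realize (Sum.elim x fun _ => y)} = centerCentralizer x :=
    Set.ext fun z => hψ x z
  have hle := hK x (heq ▸ hfin N x)
  rw [heq] at hle
  have := Set.ncard_le_ncard hsub (hfin N x)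
  rw [Set.ncard_coe_finset] at this
  omega

end

theorem mainTheorem4 (p : ℕ) (hp : p.Prime) (G : Type u) [Group G] (hinf : Infinite G)
    (hsimple : Group.IsCharacteristicallySimple G) (hpgroup : IsPGroup p G)
    (hcat : Group.IsOmegaCategorical G) (hnip : Group.HasNIP G) :
    ∃ A : Subgroup G,
      (A : Set G).Infinite ∧
      (Set.univ : Set G).Definable₁ FirstOrder.Language.group (A : Set G) ∧
      IsMulCommutative A ∧
      ∃ s : Finset G, s.Nonempty ∧
        A = (Subgroup.center ↥(⨅ x ∈ s, Subgroup.centralizer ({x} : Set G))).map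
              (Subgroup.subtype _) := by
  classical
  have : Fact p.Prime := ⟨hp⟩
  obtain ⟨N, x, hx⟩ := exists_infinite_centerCentralizer hpgroup hcat hnip
  let s : Finset G := Finset.univ.image x
  let C : Subgroup G := ⨅ y ∈ s, Subgroup.centralizer ({y} : Set G)
  have hC (c : G) : c ∈ C ↔ ∀ i, Commute c (x i) := by
    simp only [C, s, Subgroup.mem_iInf, Subgroup.mem_centralizer_singleton_iff, Finset.mem_image,
      Finset.mem_univ, true_and, forall_exists_index, forall_apply_eq_imp_iff]
    rfl
  have hA : ((Subgroup.center C).map C.subtype : Set G) = centerCentralizer x := by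
    ext z
    simp only [SetLike.mem_coe, Subgroup.mem_map, Subgroup.mem_center_iff]
    constructor
    · rintro ⟨z, hz, rfl⟩
      exact ⟨(hC z).1 z.2, fun c hc => (congrArg Subtype.val (hz ⟨c, (hC c).2 hc⟩)).symm⟩
    · intro hz
      exact ⟨⟨z, (hC z).2 hz.1⟩, fun c => Subtype.ext (hz.2 c ((hC c).1 c.2)).symm, rfl⟩
  refine ⟨(Subgroup.center C).map C.subtype, ?_, ?_, inferInstance, s, ⟨x 0, by simp [s]⟩, rfl⟩
  · rwa [hA]
  · rw [hA]
    exact definable_centerCentralizer x
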